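/- Let $\alpha\in\mathbb R$. An \emph{$\alpha$-stationary surface} is a smooth immersion of a smooth surface $\Sigma$ into $\mathbb R^3\setminus\{0\}$ whose mean curvature satisfies $$H(p)=\alpha\,\frac{\langle \nu(p),p\rangle}{|p|^2},\qquad p\in\Sigma,$$ where $\nu(p)$ is a unit normal vector at $p$, points of $\Sigma$ are identified with their images in $\mathbb R^3$, and $H$ is the sum of the principal curvatures with respect to $\nu$ (so that a sphere of radius $r$ has $H=2/r$ for the inward normal); the equation does not depend on the choice between $\nu(p)$ and $-\nu(p)$. If $\alpha<-2$, then there are no closed (that is, non-empty, compact, without boundary) $\alpha$-stationary surfaces. -/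

import Mathlib

open scoped Manifold ContDiff

noncomputable section

namespace StationarySurface

/-- The parameter plane `ℝ²`. -/
abbrev E2 : Type := EuclideanSpace ℝ (Fin 2)

/-- Euclidean space `ℝ³`. -/
abbrev E3 : Type := EuclideanSpace ℝ (Fin 3)

/-- The first partial derivative `∂ᵢ X` of a parametrization `X` at `u`. -/
def partialDeriv (X : E2 → E3) (i : Fin 2) (u : E2) : E3 :=
  fderiv ℝ X u (EuclideanSpace.single i (1 : ℝ))

/-- The matrix `gᵢⱼ = ⟨∂ᵢ X, ∂ⱼ X⟩` of the first fundamental form of `X` at `u`. -/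
def firstFundamentalForm (X : E2 → E3) (u : E2) : Matrix (Fin 2) (Fin 2) ℝ :=
  Matrix.of fun i j => inner ℝ (partialDeriv X i u) (partialDeriv X j u)

/-- The matrix `bᵢⱼ = ⟨∂ᵢ ∂ⱼ X, ν⟩` of the second fundamental form of `X` at `u` with respect to
the normal vector `ν`. -/
def secondFundamentalForm (X : E2 → E3) (ν : E3) (u : E2) : Matrix (Fin 2) (Fin 2) ℝ :=
  Matrix.of fun i j => inner ℝ (partialDeriv (partialDeriv X j) i u) ν

/-- The mean curvature at `u` of a parametrized surface `X` with respect to the unit normal `ν`: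
the trace of the shape operator `g⁻¹ b`, that is, the sum (not the average) of the principal
curvatures. A sphere of radius `r` has mean curvature `2 / r` for the inward normal. -/
def paramMeanCurvature (X : E2 → E3) (ν : E3) (u : E2) : ℝ :=
  ((firstFundamentalForm X u)⁻¹ * secondFundamentalForm X ν u).trace

variable {M : Type*} [TopologicalSpace M] [ChartedSpace E2 M]

/-- `ν` is one of the two unit vectors normal to the surface `f : M → ℝ³` at the point `p`. -/
def IsUnitNormal (f : M → E3) (p : M) (ν : E3) : Prop :=
  ‖ν‖ = 1 ∧ ∀ v : TangentSpace (𝓡 2) p, inner ℝ ν (mfderiv (𝓡 2) 𝓘(ℝ, E3) f p v : E3) = 0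

/-- The mean curvature of the surface `f : M → ℝ³` at `p` with respect to the unit normal `ν`,
computed in the local parametrization `f ∘ φ⁻¹`, where `φ` is the chart of `M` at `p`. -/
def meanCurvature (f : M → E3) (p : M) (ν : E3) : ℝ :=
  paramMeanCurvature (f ∘ (chartAt E2 p).symm) ν (chartAt E2 p p)

/-- `f : M → ℝ³ ∖ {0}` is an `α`-stationary surface: a smooth immersion that misses the origin and
satisfies `H(p) = α ⟨ν(p), p⟩ / |p|²`. Both sides change sign with `ν`, so the equation does not
depend on the choice of the unit normal at a point, and no orientation of `M` is needed. -/
structure IsStationary (α : ℝ) (f : M → E3) : Prop where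
  smooth : ContMDiff (𝓡 2) 𝓘(ℝ, E3) ∞ f
  immersion : ∀ p : M, Function.Injective (mfderiv (𝓡 2) 𝓘(ℝ, E3) f p)
  ne_zero : ∀ p : M, f p ≠ 0
  meanCurvature_eq : ∀ (p : M) (ν : E3), IsUnitNormal f p ν →
    meanCurvature f p ν = α * inner ℝ ν (f p) / ‖f p‖ ^ 2

end StationarySurface

end

namespace StationarySurface

open Filter Topology

/-! Compare the surface with the largest sphere about the origin that it encloses or touches from
outside: by compactness some point `p` of `M` is closest to the origin. There `f p / ‖f p‖` is a
unit normal, and the Hessian of `‖X‖² / 2` in a local parametrization `X` is `g + ‖X‖ b`, which is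
positive semidefinite (`hessian_norm_sq_nonneg`). Its trace against `g⁻¹` gives `2 + ‖X‖ H ≥ 0`
(`neg_two_le_norm_mul_paramMeanCurvature`). For this normal the stationary equation reads `‖X‖ H =
α`, so `α ≥ -2`. -/

/-- The second-derivative test, necessary condition: at a local minimum the second derivative is
nonnegative. -/
theorem deriv_deriv_nonneg_of_isLocalMin {φ : ℝ → ℝ} {a : ℝ} (h : IsLocalMin φ a)
    (hc : ContinuousAt φ a) : 0 ≤ deriv (deriv φ) a := by
  by_contra! hneg
  have hmax : IsLocalMax φ a := isLocalMax_of_deriv_deriv_neg hneg h.deriv_eq_zero hc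
  -- A point that is both a local minimum and a local maximum has a neighbourhood where `φ` is
  -- constant.
  have hconst : φ =ᶠ[𝓝 a] fun _ => φ a := by
    filter_upwards [h, hmax] with t h₁ h₂ using le_antisymm h₂ h₁
  have : deriv (deriv φ) a = 0 := by
    rw [hconst.deriv.deriv_eq]
    simp
  exact hneg.ne this

/-- At a local minimum of `‖X‖`, the Hessian of `‖X‖² / 2` is positive semidefinite. -/
theorem hessian_norm_sq_nonneg {E F : Type*} [NormedAddCommGroup E] [NormedSpace ℝ E]
    [NormedAddCommGroup F] [InnerProductSpace ℝ F] {X : E → F} {u : E}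
    (hX : ContDiffAt ℝ 2 X u) (hmin : IsLocalMin (fun w => ‖X w‖ ^ 2) u) (v : E) :
    0 ≤ inner ℝ (fderiv ℝ X u v) (fderiv ℝ X u v) +
      inner ℝ (X u) (fderiv ℝ (fderiv ℝ X) u v v) := by
  set γ : ℝ → E := fun t => u + t • v with hγ
  have hγ0 : γ 0 = u := by simp [hγ]
  have hγd : ∀ t, HasDerivAt γ v t := fun t => by
    simpa [hγ] using ((hasDerivAt_id t).smul_const v).const_add u
  have hγc : Tendsto γ (𝓝 0) (𝓝 u) := by
    have := (hγd 0).continuousAt.tendsto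
    rwa [hγ0] at this
  set φ : ℝ → ℝ := fun t => ‖X (γ t)‖ ^ 2 with hφ
  have hφmin : IsLocalMin φ 0 := by
    have := hγc.eventually hmin
    filter_upwards [this] with t ht
    simpa [hφ, hγ0] using ht
  have hXd : ∀ᶠ w in 𝓝 u, DifferentiableAt ℝ X w := by
    filter_upwards [hX.eventually (by simp)] with w hw using hw.differentiableAt (by simp)
  have hXγ : ∀ᶠ t in 𝓝 (0 : ℝ),
      HasDerivAt (fun t => X (γ t)) (fderiv ℝ X (γ t) v) t := by
    filter_upwards [hγc.eventually hXd] with t ht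
    exact ht.hasFDerivAt.comp_hasDerivAt t (hγd t)
  have hφd : deriv φ =ᶠ[𝓝 0] fun t => 2 * inner ℝ (X (γ t)) (fderiv ℝ X (γ t) v) := by
    filter_upwards [hXγ] with t ht using ht.norm_sq.deriv
  have hD : HasFDerivAt (fderiv ℝ X) (fderiv ℝ (fderiv ℝ X) u) (γ 0) := by
    rw [hγ0]
    exact ((hX.fderiv_right (m := 1) (by norm_num)).differentiableAt (by simp)).hasFDerivAt
  have hDγ : HasDerivAt (fun t => fderiv ℝ X (γ t) v) (fderiv ℝ (fderiv ℝ X) u v v) 0 := by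
    have := (hD.comp_hasDerivAt (0 : ℝ) (hγd 0)).clm_apply (hasDerivAt_const (0 : ℝ) v)
    simpa using this
  have hdd : deriv (deriv φ) 0 = 2 * (inner ℝ (X u) (fderiv ℝ (fderiv ℝ X) u v v) +
      inner ℝ (fderiv ℝ X u v) (fderiv ℝ X u v)) := by
    rw [hφd.deriv_eq]
    have := ((hXγ.self_of_nhds.inner ℝ hDγ).const_mul 2).deriv
    simpa only [hγ0] using this
  have hpos := deriv_deriv_nonneg_of_isLocalMin hφmin
    hXγ.self_of_nhds.norm_sq.continuousAt
  rw [hdd] at hpos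
  linarith

/-- At a local minimum of `‖X‖`, the vector `X u` is normal to the image of the derivative. -/
theorem inner_fderiv_eq_zero_of_isLocalMin {E F : Type*} [NormedAddCommGroup E] [NormedSpace ℝ E]
    [NormedAddCommGroup F] [InnerProductSpace ℝ F] {X : E → F} {u : E}
    (hX : DifferentiableAt ℝ X u) (hmin : IsLocalMin (fun w => ‖X w‖ ^ 2) u) (v : E) :
    inner ℝ (X u) (fderiv ℝ X u v) = 0 := by
  have h := hmin.hasFDerivAt_eq_zero hX.hasFDerivAt.norm_sq
  simpa using congrArg (fun L => L v) h

/-- The trace of `g⁻¹ A` is nonnegative for a positive definite symmetric `2 × 2` matrix `g` and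
a matrix `A` whose quadratic form is nonnegative. -/
theorem trace_inv_mul_nonneg {g A : Matrix (Fin 2) (Fin 2) ℝ} (hsymm : g 1 0 = g 0 1)
    (hg : 0 < g 1 1) (hdet : 0 < g.det)
    (hA : ∀ x y : ℝ, 0 ≤ x ^ 2 * A 0 0 + x * y * (A 0 1 + A 1 0) + y ^ 2 * A 1 1) :
    0 ≤ (g⁻¹ * A).trace := by
  have h11 : 0 ≤ A 1 1 := by simpa using hA 0 1
  -- Completing the square: this value plus `det g * A 1 1` equals `g 1 1` times the trace of
  -- `g.adjugate * A`.
  have hq := hA (g 1 1) (-g 0 1)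
  rw [Matrix.inv_def, Matrix.smul_mul, Matrix.trace_smul, Ring.inverse_eq_inv', smul_eq_mul]
  refine mul_nonneg (inv_nonneg.2 hdet.le) ?_
  have htr : (g.adjugate * A).trace =
      g 1 1 * A 0 0 - g 0 1 * (A 0 1 + A 1 0) + g 0 0 * A 1 1 := by
    rw [Matrix.trace_fin_two, Matrix.adjugate_fin_two]
    simp [Matrix.mul_apply, Fin.sum_univ_two, hsymm]
    ring
  rw [htr]
  refine nonneg_of_mul_nonneg_right (a := g 1 1) ?_ hg
  have hmul := mul_nonneg hdet.le h11
  rw [Matrix.det_fin_two, hsymm] at hmul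
  linarith

theorem partialDeriv_partialDeriv {X : E2 → E3} {u : E2} (hX : ContDiffAt ℝ 2 X u) (i j : Fin 2) :
    partialDeriv (partialDeriv X j) i u =
      fderiv ℝ (fderiv ℝ X) u (EuclideanSpace.single i 1) (EuclideanSpace.single j 1) := by
  have hD : DifferentiableAt ℝ (fderiv ℝ X) u :=
    (hX.fderiv_right (m := 1) (by norm_num)).differentiableAt (by simp)
  have h := (hD.hasFDerivAt.clm_apply
    (hasFDerivAt_const (EuclideanSpace.single j (1 : ℝ) : E2) u)).fderiv
  change fderiv ℝ (fun w => fderiv ℝ X w (EuclideanSpace.single j 1)) u _ = _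
  rw [h]
  simp

theorem firstFundamentalForm_comm (X : E2 → E3) (u : E2) (i j : Fin 2) :
    firstFundamentalForm X u i j = firstFundamentalForm X u j i :=
  real_inner_comm (partialDeriv X j u) (partialDeriv X i u)

theorem det_firstFundamentalForm_pos {X : E2 → E3} {u : E2}
    (hinj : Function.Injective (fderiv ℝ X u)) :
    0 < firstFundamentalForm X u 1 1 ∧ 0 < (firstFundamentalForm X u).det := by
  have hne : ∀ w : E2, w ≠ 0 → 0 < inner ℝ (fderiv ℝ X u w) (fderiv ℝ X u w) := fun w hw =>
    real_inner_self_pos.2 ((map_ne_zero_iff _ hinj).2 hw)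
  have h11 : 0 < firstFundamentalForm X u 1 1 := by
    refine hne (EuclideanSpace.single 1 1) fun h => ?_
    simpa using congrFun (congrArg WithLp.ofLp h) 1
  refine ⟨h11, ?_⟩
  set g := firstFundamentalForm X u with hg
  have hsymm : g 1 0 = g 0 1 := firstFundamentalForm_comm X u 1 0
  -- This vector is `g`-orthogonal to the second basis vector, and its `g`-square is `g 1 1 * det
  -- g`.
  have hpos := hne (g 1 1 • EuclideanSpace.single 0 1 + (-g 0 1) • EuclideanSpace.single 1 1)
    fun h => by
      have := congrFun (congrArg WithLp.ofLp h) 0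
      simp at this
      exact h11.ne' this
  have hexp : inner ℝ
      (fderiv ℝ X u (g 1 1 • EuclideanSpace.single 0 1 + (-g 0 1) • EuclideanSpace.single 1 1))
      (fderiv ℝ X u (g 1 1 • EuclideanSpace.single 0 1 + (-g 0 1) • EuclideanSpace.single 1 1)) =
      g 1 1 * (g 1 1 * g 0 0 + -g 0 1 * g 0 1) + -g 0 1 * (g 1 1 * g 1 0 + -g 0 1 * g 1 1) := by
    simp only [map_add, map_smul, inner_add_left, inner_add_right, real_inner_smul_left,
      real_inner_smul_right]
    change _ * (_ * g 0 0) + _ * (_ * g 1 0) + (_ * (_ * g 0 1) + _ * (_ * g 1 1)) = _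
    ring
  rw [hexp, hsymm] at hpos
  rw [Matrix.det_fin_two, hsymm]
  refine pos_of_mul_pos_right (a := g 1 1) ?_ h11.le
  linarith

/-- At a nonzero point of an immersed surface closest to the origin, the mean curvature with
respect to the outward normal is at least `-2 / ‖X u‖`. -/
theorem neg_two_le_norm_mul_paramMeanCurvature {X : E2 → E3} {u : E2} (hX : ContDiffAt ℝ 2 X u)
    (hinj : Function.Injective (fderiv ℝ X u)) (h0 : X u ≠ 0)
    (hmin : IsLocalMin (fun w => ‖X w‖ ^ 2) u) :
    -2 ≤ ‖X u‖ * paramMeanCurvature X (‖X u‖⁻¹ • X u) u := by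
  set g := firstFundamentalForm X u with hg
  set b := secondFundamentalForm X (‖X u‖⁻¹ • X u) u with hb
  obtain ⟨h11, hdet⟩ := det_firstFundamentalForm_pos hinj
  have hr : ‖X u‖ ≠ 0 := norm_ne_zero_iff.2 h0
  have hentry : ∀ i j, ‖X u‖ * b i j = inner ℝ (X u)
      (fderiv ℝ (fderiv ℝ X) u (EuclideanSpace.single i 1) (EuclideanSpace.single j 1)) := by
    intro i j
    rw [← partialDeriv_partialDeriv hX, real_inner_comm]
    simp only [hb, secondFundamentalForm, Matrix.of_apply, real_inner_smul_right]
    field_simp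
  have htr : 0 ≤ (g⁻¹ * (g + ‖X u‖ • b)).trace := by
    refine trace_inv_mul_nonneg (firstFundamentalForm_comm X u 1 0) h11 hdet fun x y => ?_
    have h := hessian_norm_sq_nonneg hX hmin
      (x • EuclideanSpace.single 0 1 + y • EuclideanSpace.single 1 1)
    simp only [map_add, map_smul, inner_add_left, inner_add_right, real_inner_smul_left,
      real_inner_smul_right, add_apply, smul_apply, smul_add,
      ← hentry] at h
    simp only [Matrix.add_apply, Matrix.smul_apply, smul_eq_mul]
    change 0 ≤ _ * (_ * g 0 0) + _ * (_ * g 1 0) + (_ * (_ * g 0 1) + _ * (_ * g 1 1)) + _ at h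
    linarith
  rw [mul_add, Matrix.nonsing_inv_mul _ (isUnit_iff_ne_zero.2 hdet.ne'), Matrix.trace_add,
    Matrix.mul_smul, Matrix.trace_smul, Matrix.trace_one, Fintype.card_fin, smul_eq_mul] at htr
  change -2 ≤ ‖X u‖ * (g⁻¹ * b).trace
  push_cast at htr
  linarith

section Chart

variable {E F M : Type*} [NormedAddCommGroup E] [NormedSpace ℝ E] [NormedAddCommGroup F]
  [NormedSpace ℝ F] [TopologicalSpace M] [ChartedSpace E M]

theorem contDiffAt_comp_chartAt_symm {f : M → F} {p : M} {n : ℕ∞ω}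
    (hf : ContMDiffAt 𝓘(ℝ, E) 𝓘(ℝ, F) n f p) :
    ContDiffAt ℝ n (f ∘ (chartAt E p).symm) (chartAt E p p) := by
  have h := (contMDiffAt_iff.1 hf).2
  simp only [mfld_simps] at h
  exact contDiffWithinAt_univ.1 h

theorem mfderiv_eq_fderiv_comp_chartAt_symm {f : M → F} {p : M}
    (hf : MDifferentiableAt 𝓘(ℝ, E) 𝓘(ℝ, F) f p) :
    mfderiv 𝓘(ℝ, E) 𝓘(ℝ, F) f p = fderiv ℝ (f ∘ (chartAt E p).symm) (chartAt E p p) := by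
  rw [hf.mfderiv]
  simp only [writtenInExtChartAt, mfld_simps]
  exact congrFun fderivWithin_univ _

end Chart

end StationarySurface

open StationarySurface in
theorem mainTheorem10 (α : ℝ) (hα : α < -2)
    {M : Type*} [TopologicalSpace M] [T2Space M] [CompactSpace M] [Nonempty M]
    [ChartedSpace (EuclideanSpace ℝ (Fin 2)) M] [IsManifold (𝓡 2) ∞ M]
    (f : M → EuclideanSpace ℝ (Fin 3)) :
    ¬ StationarySurface.IsStationary α f := by
  intro hf
  obtain ⟨p, -, hp⟩ := isCompact_univ.exists_isMinOn Set.univ_nonempty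
    hf.smooth.continuous.norm.continuousOn
  set φ := chartAt E2 p with hφ
  set X : E2 → E3 := f ∘ φ.symm with hXdef
  have hXp : X (φ p) = f p := congrArg f (φ.left_inv (mem_chart_source E2 p))
  have hX : ContDiffAt ℝ ∞ X (φ p) := contDiffAt_comp_chartAt_symm (hf.smooth p)
  have hmf : ∀ v : E2, (mfderiv (𝓡 2) 𝓘(ℝ, E3) f p v : E3) = fderiv ℝ X (φ p) v := fun v =>
    DFunLike.congr_fun (mfderiv_eq_fderiv_comp_chartAt_symm
      ((hf.smooth p).mdifferentiableAt (by simp))) v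
  have hinj : Function.Injective (fderiv ℝ X (φ p)) := fun v w h =>
    hf.immersion p ((hmf v).trans (h.trans (hmf w).symm))
  -- Even outside the chart's target, `φ.symm w` is a point of `M`, so global minimality at `p`
  -- applies to every `w`.
  have hmin : IsLocalMin (fun w => ‖X w‖ ^ 2) (φ p) := Filter.Eventually.of_forall fun w => by
    have : ‖f p‖ ≤ ‖X w‖ := hp (Set.mem_univ (φ.symm w))
    simp only [hXp]
    gcongr
  have h0 := hf.ne_zero p
  have hr : ‖f p‖ ≠ 0 := norm_ne_zero_iff.2 h0
  have hν : IsUnitNormal f p (‖f p‖⁻¹ • f p) := by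
    refine ⟨norm_smul_inv_norm h0, fun v => ?_⟩
    refine (real_inner_smul_left (f p) _ _).trans (mul_eq_zero_of_right _ ?_)
    exact (congrArg₂ (inner ℝ) hXp.symm (hmf v)).trans
      (inner_fderiv_eq_zero_of_isLocalMin (hX.differentiableAt (by simp)) hmin v)
  have hle := neg_two_le_norm_mul_paramMeanCurvature (contDiffAt_infty.1 hX 2) hinj
    (hXp ▸ h0) hmin
  have hH : paramMeanCurvature X (‖f p‖⁻¹ • f p) (φ p) = _ := hf.meanCurvature_eq p _ hν
  rw [hXp, hH, real_inner_smul_left, real_inner_self_eq_norm_sq] at hle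
  have : ‖f p‖ * (α * (‖f p‖⁻¹ * ‖f p‖ ^ 2) / ‖f p‖ ^ 2) = α := by field_simp
  linarith
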